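/- Consider a network source $\to$ relay $\to$ destination with time slots $t=0,1,2,\dots$. An $(n_1,n_2,k,T)_q$ streaming code consists of arbitrary (possibly time-varying) maps as follows. At time $t$ the source sends $x(t)\in\mathbb F_q^{n_1}$, a function of the message packets $m(0),\dots,m(t)\in\mathbb F_q^k$. The relay receives either $x(t)$ or an erasure symbol $*$, and sends $y(t)\in\mathbb F_q^{n_2}$, a function of everything it has received in slots $0,\dots,t$ (erasure symbols included). The destination receives either $y(t)$ or $*$, and at time $t+T$ outputs an estimate $\hat m(t)\in\mathbb F_q^k$, a function of everything it has received in slots $0,\dots,t+T$. The rate of the code is $k/\max(n_1,n_2)$. The code is $(N_1,N_2,T)$-achievable if $\hat m(t)=m(t)$ for all $t$, for every message sequence, every pattern of at most $N_1$ erasures (over all time slots) on the source-relay link and every pattern of at most $N_2$ erasures (over all time slots) on the relay-destination link. Theorem. Let $N_1,N_2,T\ge 0$ be integers with $N_1+N_2\le T$, and let $q$ be any prime power. There are numbers $\delta_c$ ($c=1,2,\dots$) with $$0\le \delta_c\le \frac1c\left\lceil (T+1)\log_q 2\right\rceil ,\qquad \delta_c\to0\ \text{ as } c\to\infty,$$ such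 that for every integer $c\ge1$ there is an $(N_1,N_2,T)$-achievable $(n_1,n_2,k,T)_q$ streaming code (for some $n_1,n_2,k$ that may depend on $c$) whose rate is exactly $\min(R_1,R_2)$, where $$R_1=\frac{T+1-N_1-N_2}{T+1-N_2},\qquad R_2=\frac{T+1-N_2}{T+1+\sum_{i=0}^{N_1}\frac{N_1-i}{T+1-N_2-(N_1-i)}+\delta_c}.$$ -/

import Mathlib

open Filter Topology

/-- A streaming code over the alphabet `F` for the three-node (source, relay, destination) network,
with message packets in `F ^ k`, source packets in `F ^ n₁`, relay packets in `F ^ n₂` and decoding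
delay `T`.  A received packet is an element of `Option (Fin n → F)`, where `none` is the erasure
symbol.  All encoders and decoders are causal and may vary with time; the relay encoder sees which
source packets were erased, and the packet of slot `t` is decoded from slots `0, …, t + T`. -/
structure StreamingCode (F : Type*) (n₁ n₂ k T : ℕ) where
  /-- Source encoder at time `t`, applied to the messages of times `0, …, t`. -/
  encS : (t : ℕ) → (Fin (t + 1) → (Fin k → F)) → (Fin n₁ → F)
  /-- Relay encoder at time `t`, applied to the packets received by the relay at `0, …, t`. -/
  encR : (t : ℕ) → (Fin (t + 1) → Option (Fin n₁ → F)) → (Fin n₂ → F)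
  /-- Decoder of the message of time `t`, applied to the packets received by the destination at
  times `0, …, t + T`. -/
  dec : (t : ℕ) → (Fin (t + T + 1) → Option (Fin n₂ → F)) → (Fin k → F)

/-- Transmission of a packet through an erasure link: `e = true` means that it is erased. -/
def erase {α : Type*} (e : Bool) (x : α) : Option α :=
  if e then none else some x

/-- An erasure sequence with at most `N` erasures over all time slots `0, 1, 2, …`. -/
def IsErasureSequence (N : ℕ) (e : ℕ → Bool) : Prop :=
  {t : ℕ | e t = true}.encard ≤ (N : ℕ∞)

namespace StreamingCode

variable {F : Type*} {n₁ n₂ k T : ℕ}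

/-- The rate `k / max (n₁, n₂)` of a code. -/
noncomputable def rate (_C : StreamingCode F n₁ n₂ k T) : ℝ :=
  (k : ℝ) / ((max n₁ n₂ : ℕ) : ℝ)

/-- The source packet `x(t)` for the message sequence `m`. -/
def sourcePacket (C : StreamingCode F n₁ n₂ k T) (m : ℕ → Fin k → F) (t : ℕ) : Fin n₁ → F :=
  C.encS t (fun s => m s)

/-- The packet `x_R(t)` received by the relay. -/
def relayReceived (C : StreamingCode F n₁ n₂ k T) (m : ℕ → Fin k → F) (eS : ℕ → Bool) (t : ℕ) :
    Option (Fin n₁ → F) :=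
  erase (eS t) (C.sourcePacket m t)

/-- The relay packet `y(t)`. -/
def relayPacket (C : StreamingCode F n₁ n₂ k T) (m : ℕ → Fin k → F) (eS : ℕ → Bool) (t : ℕ) :
    Fin n₂ → F :=
  C.encR t (fun s => C.relayReceived m eS s)

/-- The packet `y_D(t)` received by the destination. -/
def destReceived (C : StreamingCode F n₁ n₂ k T) (m : ℕ → Fin k → F) (eS eR : ℕ → Bool) (t : ℕ) :
    Option (Fin n₂ → F) :=
  erase (eR t) (C.relayPacket m eS t)

/-- The destination's reconstruction of `m(t)`, formed at time `t + T`. -/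
def decoded (C : StreamingCode F n₁ n₂ k T) (m : ℕ → Fin k → F) (eS eR : ℕ → Bool) (t : ℕ) :
    Fin k → F :=
  C.dec t (fun s => C.destReceived m eS eR s)

/-- `(N₁, N₂, T)`-achievability: every message packet of every message sequence is reconstructed
exactly whenever the first link has at most `N₁` erasures and the second at most `N₂`. -/
def IsAchievable (C : StreamingCode F n₁ n₂ k T) (N₁ N₂ : ℕ) : Prop :=
  ∀ (m : ℕ → Fin k → F) (eS eR : ℕ → Bool),
    IsErasureSequence N₁ eS → IsErasureSequence N₂ eR →
      ∀ t : ℕ, C.decoded m eS eR t = m t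

end StreamingCode

/-!
Put `D = T + 1 - N₂` and `k = D - N₁`. The code works over a finite extension `K` of `F` and uses
`L` interleaved copies of a basic code, so that a message has `n = k * L` symbols, in `k` groups of
`L`.

*Source.* Each copy is a diagonally interleaved systematic Reed–Solomon code of length `D` and
dimension `k`. Its rate is `R₁`. If the source packet of slot `t` arrives, the relay knows the
message of slot `t` at once. Otherwise, each later packet that arrives completes one more of the
codewords through slot `t`, but only modulo symbols of messages older than `t`, which the relay may
not know. It interpolates as if they were zero. The resulting estimate is the true symbol plus
interference from older messages only (`estimate_sub_estimate`). The destination has already decoded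
those, so the interference is harmless.

*Relay.* In slot `s` the relay spends `n / D` symbols on a message whose source packet arrived, and
`n / (D - j)` symbols on one whose packet was lost, where `j` counts the erasures since then
(`relayShare`). The symbols are generic combinations of the estimates available so far. Of the
`T + 1` relay packets that concern a message, at least `D` arrive. If source packet `t` was lost and
`j` erasures have occurred in the slots `t, …, t + d`, then `d + 1 - j` groups of symbols are
available, and the at least `D - 1 - d` later packets that arrive supply the rest, since
`(D - 1 - d) * (n / (D - j)) ≥ (k - (d + 1 - j)) * L`. This Hall-type condition makes generic
combinations decodable (`eq_zero_of_generic_combinations`, `eq_zero_of_relay_combinations`).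

*Size.* The lost messages in the window are ordered by time, so their counts `j` are `1, 2, …`.
Hence the shares add up to at most `∑_{j = 1}^{N₁} n / (D - j) + (T + 1 - N₁) * n / D`
(`sum_shareOfRecent_le`), which is `1 / D` times `n` times the denominator of `R₂` without `δ_c`.
A header of `T + 1` bits tells the destination how the packet is divided. With `δ_c = 1 / c` and `L`
a large multiple of `c`, the slack exceeds the header, and padding makes the rate exact.

Since only the numbers of possible packets matter, packets are taken from convenient finite sets and
embedded into vectors over `F`, and decoding is proved by showing that two transmissions that look
the same to the destination carry the same messages (`message_eq_of_received_eq`).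
-/

/-! ### Generic matrices over finite extensions -/

/-- The matrix `G`, with rows indexed by `0, …, m - 1`, is *generic* if every square matrix made of
`n` distinct rows of `G` stays invertible when entries off the diagonal are replaced by zeros, in
any pattern. Here `Z i` is the set of columns that are kept in the `i`-th selected row. -/
def IsGenericMatrix {K : Type*} [Field K] {n : ℕ} (m : ℕ) (G : ℕ → Fin n → K) : Prop :=
  ∀ r : Fin n → ℕ, Function.Injective r → (∀ i, r i < m) →
    ∀ Z : Fin n → Finset (Fin n), (∀ i, i ∈ Z i) →
      (Matrix.of fun i j => if j ∈ Z i then G (r i) j else 0).det ≠ 0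

theorem exists_isGenericMatrix (A : Type*) [Field A] [Infinite A] (n m : ℕ) :
    ∃ G : ℕ → Fin n → A, IsGenericMatrix m G := by
  classical
  let I := {p : (Fin n → Fin m) × (Fin n → Finset (Fin n)) //
    Function.Injective p.1 ∧ ∀ i, i ∈ p.2 i}
  let P : I → MvPolynomial (Fin m × Fin n) A := fun p =>
    (Matrix.of fun i j => if j ∈ p.1.2 i then MvPolynomial.X (p.1.1 i, j) else 0).det
  have hev : ∀ (x : Fin m × Fin n → A) (p : I), MvPolynomial.eval x (P p) =
      (Matrix.of fun i j => if j ∈ p.1.2 i then x (p.1.1 i, j) else 0).det := by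
    intro x p
    rw [RingHom.map_det]
    congr 1
    ext i j
    simp only [RingHom.mapMatrix_apply, Matrix.map_apply, Matrix.of_apply]
    split_ifs <;> simp
  have hP : ∀ p, P p ≠ 0 := by
    rintro ⟨⟨r, Z⟩, hr, hZ⟩ h0
    -- Specialising the selected rows to unit vectors turns the matrix into the identity.
    have h1 := hev (fun q => if r q.2 = q.1 then 1 else 0) ⟨⟨r, Z⟩, hr, hZ⟩
    rw [h0, map_zero] at h1
    have h2 : (Matrix.of fun i j : Fin n => if j ∈ Z i then
        (if r j = r i then (1 : A) else 0) else 0) = 1 := by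
      ext i j
      by_cases hij : i = j
      · subst hij; simp [hZ]
      · have : r j ≠ r i := fun h => hij (hr h).symm
        simp [hij, this]
    simp only [h2, Matrix.det_one] at h1
    exact zero_ne_one h1
  have hprod : ∏ p, P p ≠ 0 := Finset.prod_ne_zero_iff.2 fun p _ => hP p
  obtain ⟨x, hx⟩ : ∃ x, MvPolynomial.eval x (∏ p, P p) ≠ 0 := by
    by_contra! h
    exact hprod (MvPolynomial.funext fun x => by simpa using h x)
  rw [map_prod, Finset.prod_ne_zero_iff] at hx
  refine ⟨fun ρ j => if h : ρ < m then x (⟨ρ, h⟩, j) else 0, fun r hr hrm Z hZ => ?_⟩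
  have h := hx ⟨⟨fun i => ⟨r i, hrm i⟩, Z⟩, fun i j hij => hr (by simpa using hij), hZ⟩
    (Finset.mem_univ _)
  rw [hev] at h
  simpa [hrm] using h

/-- Over a finite field only small generic matrices exist, so the code works over a suitable finite
extension of `F`: it is generated by the finitely many entries of a generic matrix over the
algebraic closure, together with enough evaluation points for a Reed–Solomon code. -/
theorem exists_extension_isGenericMatrix.{u} (F : Type u) [Field F] [Fintype F] (n m D : ℕ) :
    ∃ (K : Type u) (_ : Field K) (_ : Fintype K) (d : ℕ),
      0 < d ∧ Fintype.card K = Fintype.card F ^ d ∧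
        (∃ α : ℕ → K, Set.InjOn α (Set.Iio D)) ∧ ∃ G : ℕ → Fin n → K, IsGenericMatrix m G := by
  classical
  let A := AlgebraicClosure F
  obtain ⟨G, hG⟩ := exists_isGenericMatrix A n m
  let α := Infinite.natEmbedding A
  let S : Set A := (Set.range fun p : Fin m × Fin n => G p.1 p.2) ∪ α '' Set.Iio D
  have hS : S.Finite := (Set.finite_range _).union ((Set.finite_Iio D).image _)
  let K := IntermediateField.adjoin F S
  have : Finite S := hS
  have hfd : FiniteDimensional F K :=
    IntermediateField.finiteDimensional_adjoin fun x _ => Algebra.IsIntegral.isIntegral x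
  have hfin : Finite K := Module.finite_of_finite F
  let _ : Fintype K := Fintype.ofFinite K
  have hsub : S ⊆ K := IntermediateField.subset_adjoin F S
  refine ⟨K, inferInstance, inferInstance, Module.finrank F K, Module.finrank_pos,
    Module.card_eq_pow_finrank, ?_, ?_⟩
  · refine ⟨fun p => if h : p < D then ⟨α p, hsub (Or.inr ⟨p, h, rfl⟩)⟩ else 0, ?_⟩
    intro p hp q hq hpq
    have hp' : p < D := hp
    have hq' : q < D := hq
    simpa [hp', hq'] using hpq
  · refine ⟨fun ρ j => if h : ρ < m then ⟨G ρ j, hsub (Or.inl ⟨(⟨ρ, h⟩, j), rfl⟩)⟩ else 0, ?_⟩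
    intro r hr hrm Z hZ h0
    refine hG r hr hrm Z hZ ?_
    have h1 := congrArg (algebraMap K A) h0
    rw [RingHom.map_det, map_zero] at h1
    refine (congrArg Matrix.det ?_).trans h1
    ext i j
    simp only [RingHom.mapMatrix_apply, Matrix.map_apply, Matrix.of_apply, hrm, dif_pos]
    split_ifs <;> simp [K]

/-- Decoding of a relay code with growing information. In slot `d` the relay sends `a d` generic
combinations of the coordinates in `Z d`, which comprise all coordinates from `b d` on. The slots
in `S` determine the vector once the slots after `d` supply at least the `b d` coordinates that
slot `d` may lack. Rows of `G` are numbered so that later slots come first: the `i`-th received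
row is then matched with coordinate `i`. -/
theorem eq_zero_of_generic_combinations {K : Type*} [Field K] {n T : ℕ} {G : ℕ → Fin n → K}
    (hG : IsGenericMatrix ((T + 1) * n) G) {S : Finset ℕ} (hS : ∀ d ∈ S, d ≤ T)
    {a b : ℕ → ℕ} (ha : ∀ d, a d ≤ n) {Z : ℕ → Finset (Fin n)}
    (hZ : ∀ d ∈ S, ∀ j : Fin n, b d ≤ j → j ∈ Z d)
    (htot : n ≤ ∑ d ∈ S, a d) (hb : ∀ d ∈ S, b d ≤ ∑ d' ∈ S.filter (d < ·), a d')
    {v : Fin n → K}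
    (hv : ∀ d ∈ S, ∀ l < a d, ∑ j ∈ Z d, G ((T - d) * n + l) j * v j = 0) : v = 0 := by
  classical
  let f : (Σ _ : ℕ, ℕ) → ℕ := fun x => (T - x.1) * n + x.2
  have hcard : ∀ U ⊆ S, ((U.sigma fun d => Finset.range (a d)).image f).card = ∑ d ∈ U, a d := by
    intro U hU
    rw [Finset.card_image_of_injOn, Finset.card_sigma]
    · simp
    · rintro ⟨d, l⟩ h ⟨d', l'⟩ h' hf
      simp only [Finset.coe_sigma, Set.mem_sigma_iff, Finset.mem_coe, Finset.mem_range] at h h'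
      have hl := h.2.trans_le (ha d)
      have hl' := h'.2.trans_le (ha d')
      have hn : 0 < n := by omega
      have h1 : (T - d) = (T - d') := by
        have := congrArg (· / n) hf
        simpa [f, mul_comm _ n, Nat.mul_add_div hn, Nat.div_eq_of_lt hl,
          Nat.div_eq_of_lt hl'] using this
      have h2 : d = d' := by have := hS d (hU h.1); have := hS d' (hU h'.1); omega
      subst h2
      have : l = l' := by simpa [f] using hf
      rw [this]
  let Q := (S.sigma fun d => Finset.range (a d)).image f
  have hQ : n ≤ Q.card := htot.trans_eq (hcard S subset_rfl).symm
  have hfinite : (Set.ofPred (· ∈ Q)).Finite := Q.finite_toSet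
  have hlt : ∀ i : Fin n, ∀ hf : (Set.ofPred (· ∈ Q)).Finite, (i : ℕ) < hf.toFinset.card := by
    intro i hf
    rw [show hf.toFinset = Q from Finset.ext fun x => hf.mem_toFinset.trans Iff.rfl]
    exact i.2.trans_le hQ
  let r : Fin n → ℕ := fun i => Nat.nth (· ∈ Q) i
  have hrQ : ∀ i, r i ∈ Q := fun i => Nat.nth_mem i (hlt i)
  have hrinj : Function.Injective r := by
    intro i j hij
    have := Nat.nth_injOn hfinite (hlt i hfinite) (hlt j hfinite) hij
    exact Fin.ext this
  have hcount : ∀ i, (Q.filter (· < r i)).card = i := by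
    intro i
    have h := Nat.count_nth (p := (· ∈ Q)) (hlt i)
    rw [Nat.count_eq_card_filter_range] at h
    rw [← h]
    congr 1
    ext x
    simp [r, and_comm]
  have hdec : ∀ i, ∃ d ∈ S, ∃ l < a d, (T - d) * n + l = r i := by
    intro i
    obtain ⟨⟨d, l⟩, hx, hx'⟩ := Finset.mem_image.1 (hrQ i)
    simp only [Finset.mem_sigma, Finset.mem_range] at hx
    exact ⟨d, hx.1, l, hx.2, hx'⟩
  choose d hd l hl hdl using hdec
  have hi : ∀ i, i ∈ Z (d i) := by
    intro i
    refine hZ _ (hd i) i ((hb _ (hd i)).trans ?_)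
    refine ((hcard _ (Finset.filter_subset _ _)).symm.trans_le
      (Finset.card_le_card fun x hx => ?_)).trans_eq (hcount i)
    obtain ⟨⟨d', l'⟩, hy, rfl⟩ := Finset.mem_image.1 hx
    simp only [Finset.mem_sigma, Finset.mem_range, Finset.mem_filter] at hy
    refine Finset.mem_filter.2 ⟨Finset.mem_image.2 ⟨⟨d', l'⟩, by simp [hy], rfl⟩, ?_⟩
    rw [← hdl]
    have h1 := hy.2.trans_le (ha d')
    have h2 : T - d' + 1 ≤ T - d i := by have := hS d' hy.1.1; omega
    have h3 := Nat.mul_le_mul_right n h2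
    change (T - d') * n + l' < (T - d i) * n + l i
    rw [add_mul] at h3
    omega
  refine Matrix.eq_zero_of_mulVec_eq_zero (hG r hrinj (fun i => ?_) (fun i => Z (d i)) hi) ?_
  · rw [← hdl]
    have h1 := (hl i).trans_le (ha (d i))
    have h3 := Nat.mul_le_mul_right n (show T - d i + 1 ≤ T + 1 by omega)
    rw [add_mul] at h3
    omega
  · ext i
    simp only [Matrix.mulVec, dotProduct, Matrix.of_apply, Pi.zero_apply, ite_mul, zero_mul]
    rw [← Finset.sum_filter, ← hv _ (hd i) _ (hl i), hdl]
    simp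

/-! ### The source code: diagonally interleaved Reed–Solomon codes -/

theorem injOn_range_of_injOn_Iio {K : Type*} {α : ℕ → K} {D : ℕ}
    (hα : Set.InjOn α (Set.Iio D)) {s : Finset ℕ}
    (hs : ∀ p ∈ s, p < D) : Set.InjOn α s :=
  hα.mono fun p hp => hs p hp

section SourceCode

variable {K : Type*} [Field K]

/-- The Reed–Solomon polynomial of degree less than `k` whose codeword has its symbol of position
`p` in slot `τ`, and hence its symbol of position `i` in slot `τ + i - p`. Its values at the first
`k` evaluation points are message symbols; those of slots before `0` are set to zero. -/
noncomputable def diagPoly (α : ℕ → K) (k : ℕ) (u : ℕ → ℕ → K) (τ p : ℕ) : Polynomial K :=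
  Lagrange.interpolate (Finset.range k) α fun i => if p ≤ τ + i then u (τ + i - p) i else 0

/-- The symbol of position `p` in the source packet of slot `τ`; positions below `k` are
systematic. For those the interpolation polynomial is avoided, as its other nodes may lie in the
future. -/
noncomputable def sourceSymbol (α : ℕ → K) (k : ℕ) (u : ℕ → ℕ → K) (τ p : ℕ) : K :=
  if p < k then u τ p else (diagPoly α k u τ p).eval (α p)

variable {α : ℕ → K} {k D : ℕ}

theorem eval_diagPoly (hα : Set.InjOn α (Set.Iio D)) (hk : k ≤ D) (u : ℕ → ℕ → K) (τ p : ℕ)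
    {i : ℕ} (hi : i < k) :
    (diagPoly α k u τ p).eval (α i) = if p ≤ τ + i then u (τ + i - p) i else 0 := by
  rw [diagPoly, Lagrange.eval_interpolate_at_node _
    (injOn_range_of_injOn_Iio hα fun p hp => (Finset.mem_range.1 hp).trans_le hk)
    (Finset.mem_range.2 hi)]

theorem degree_diagPoly_lt (hα : Set.InjOn α (Set.Iio D)) (hk : k ≤ D) (u : ℕ → ℕ → K)
    (τ p : ℕ) : (diagPoly α k u τ p).degree < k := by
  have h := Lagrange.degree_interpolate_lt (s := Finset.range k) (v := α)
    (fun i => if p ≤ τ + i then u (τ + i - p) i else 0)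
    (injOn_range_of_injOn_Iio hα fun p hp => (Finset.mem_range.1 hp).trans_le hk)
  rwa [Finset.card_range] at h

theorem diagPoly_add_add (u : ℕ → ℕ → K) (τ p d : ℕ) :
    diagPoly α k u (τ + d) (p + d) = diagPoly α k u τ p := by
  unfold diagPoly
  congr 1
  funext i
  have h1 : (p + d ≤ τ + d + i) ↔ (p ≤ τ + i) := by omega
  have h2 : τ + d + i - (p + d) = τ + i - p := by omega
  simp only [h1, h2]

theorem sourceSymbol_eq_eval (hα : Set.InjOn α (Set.Iio D)) (hk : k ≤ D) (u : ℕ → ℕ → K)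
    (τ p : ℕ) : sourceSymbol α k u τ p = (diagPoly α k u τ p).eval (α p) := by
  unfold sourceSymbol
  split_ifs with h
  · rw [eval_diagPoly hα hk u τ p h]
    simp
  · rfl

theorem sourceSymbol_congr {u u' : ℕ → ℕ → K} {τ : ℕ} (h : ∀ s ≤ τ, u s = u' s) (p : ℕ) :
    sourceSymbol α k u τ p = sourceSymbol α k u' τ p := by
  unfold sourceSymbol
  split_ifs with hp
  · rw [h τ le_rfl]
  · congr 1
    unfold diagPoly
    refine Lagrange.interpolate_eq_of_values_eq_on _ _ ?_
    intro i hi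
    have := Finset.mem_range.1 hi
    split_ifs
    · rw [h _ (by omega)]
    · rfl

/-- The positions `p ≥ c`, in the codeword that has position `c` in slot `t`, whose symbols have
arrived unerased by slot `s`; `e` is the erasure pattern. -/
def seenPositions (e : ℕ → Bool) (D t c s : ℕ) : Finset ℕ :=
  (Finset.Ico c D).filter fun p => t + (p - c) ≤ s ∧ e (t + (p - c)) = false

/-- The relay's estimate, in slot `s`, of symbol `c` of the message of slot `t`: the value obtained
by interpolating the received symbols `x` of the codeword from position `c` on, as if all its
earlier symbols were zero. -/
noncomputable def estimate (α : ℕ → K) (D : ℕ) (e : ℕ → Bool) (x : ℕ → ℕ → K) (t c s : ℕ) : K :=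
  (Lagrange.interpolate (Finset.range c ∪ seenPositions e D t c s) α
    fun p => if p < c then 0 else x (t + (p - c)) p).eval (α c)

/-- An estimate made from enough symbols is the true symbol up to interference that depends only on
older messages: if these agree in two transmissions, the estimates differ as the symbols do. -/
theorem estimate_sub_estimate (hα : Set.InjOn α (Set.Iio D)) (hk : k ≤ D) {e : ℕ → Bool}
    {u u' x x' : ℕ → ℕ → K} {t c s : ℕ} (hc : c < k)
    (hcard : k - c ≤ (seenPositions e D t c s).card) (hu : ∀ τ < t, u τ = u' τ)
    (hx : ∀ τ, t ≤ τ → τ ≤ s → e τ = false → ∀ p < D, x τ p = sourceSymbol α k u τ p)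
    (hx' : ∀ τ, t ≤ τ → τ ≤ s → e τ = false → ∀ p < D, x' τ p = sourceSymbol α k u' τ p) :
    estimate α D e x t c s - estimate α D e x' t c s = u t c - u' t c := by
  have hmem : ∀ p ∈ Finset.range c ∪ seenPositions e D t c s, p < D := by
    intro p hp
    simp only [seenPositions, Finset.mem_union, Finset.mem_range, Finset.mem_filter,
      Finset.mem_Ico] at hp
    omega
  have hdisj : Disjoint (Finset.range c) (seenPositions e D t c s) := by
    rw [Finset.disjoint_left]
    intro p hp hp'
    simp only [seenPositions, Finset.mem_range, Finset.mem_filter, Finset.mem_Ico] at hp hp'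
    omega
  set P := diagPoly α k u t c - diagPoly α k u' t c with hP
  have hdeg : P.degree < (Finset.range c ∪ seenPositions e D t c s).card := by
    rw [Finset.card_union_of_disjoint hdisj, Finset.card_range]
    refine ((Polynomial.degree_sub_le _ _).trans_lt (max_lt (degree_diagPoly_lt hα hk u t c)
      (degree_diagPoly_lt hα hk u' t c))).trans_le ?_
    exact_mod_cast (by omega : k ≤ c + (seenPositions e D t c s).card)
  have hPeq := Lagrange.eq_interpolate_of_eval_eq
    (fun p => (if p < c then 0 else x (t + (p - c)) p) - (if p < c then 0 else x' (t + (p - c)) p))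
    (injOn_range_of_injOn_Iio hα hmem) hdeg ?_
  · have h1 : P.eval (α c) = u t c - u' t c := by
      rw [hP, Polynomial.eval_sub, eval_diagPoly hα hk _ _ _ hc, eval_diagPoly hα hk _ _ _ hc]
      simp
    unfold estimate
    rw [← h1, hPeq, ← Polynomial.eval_sub, ← map_sub]
    rfl
  · intro p hp
    have hpD := hmem p hp
    rw [hP, Polynomial.eval_sub]
    by_cases hpc : p < c
    · rw [eval_diagPoly hα hk _ _ _ (hpc.trans hc), eval_diagPoly hα hk _ _ _ (hpc.trans hc)]
      simp only [hpc, if_true, sub_zero]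
      split_ifs
      · rw [hu _ (by omega), sub_self]
      · exact sub_zero 0
    · have hps : t + (p - c) ≤ s ∧ e (t + (p - c)) = false := by
        simp only [seenPositions, Finset.mem_union, Finset.mem_range, Finset.mem_filter] at hp
        tauto
      simp only [hpc, if_false]
      rw [hx _ (Nat.le_add_right _ _) hps.1 hps.2 p hpD,
        hx' _ (Nat.le_add_right _ _) hps.1 hps.2 p hpD, sourceSymbol_eq_eval hα hk,
        sourceSymbol_eq_eval hα hk]
      obtain ⟨d, rfl⟩ := Nat.exists_eq_add_of_le (not_lt.1 hpc)
      rw [Nat.add_sub_cancel_left, diagPoly_add_add, diagPoly_add_add]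

end SourceCode

/-! ### The rate at which the relay describes a message -/

/-- The number of erasures in the slots `t, …, s`. -/
def erasureCount (e : ℕ → Bool) (t s : ℕ) : ℕ :=
  ((Finset.Icc t s).filter fun τ => e τ = true).card

theorem erasureCount_mono (e : ℕ → Bool) (t : ℕ) {s s' : ℕ} (h : s ≤ s') :
    erasureCount e t s ≤ erasureCount e t s' :=
  Finset.card_le_card (Finset.filter_subset_filter _ (Finset.Icc_subset_Icc_right h))

theorem IsErasureSequence.card_filter_le {N : ℕ} {e : ℕ → Bool} (he : IsErasureSequence N e)
    (A : Finset ℕ) : (A.filter fun τ => e τ = true).card ≤ N := by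
  have h : ((A.filter fun τ => e τ = true : Finset ℕ) : Set ℕ) ⊆ {t : ℕ | e t = true} := by
    intro x hx
    exact (Finset.mem_filter.1 hx).2
  have h1 := (Set.encard_le_encard h).trans he
  rw [Set.encard_coe_eq_coe_finsetCard] at h1
  exact_mod_cast h1

theorem card_seenPositions {e : ℕ → Bool} {N k t c d : ℕ} (he : ∀ s, erasureCount e t s ≤ N)
    (hc : c < k) :
    min (d + 1 - erasureCount e t (t + d)) (k - c) ≤
      (seenPositions e (k + N) t c (t + d)).card := by
  set w := min d (k + N - 1 - c) with hw
  have h1 : w + 1 - erasureCount e t (t + w) ≤ (seenPositions e (k + N) t c (t + d)).card := by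
    have h2 : ((Finset.Icc t (t + w)).filter fun τ => ¬ e τ = true).card ≤
        (seenPositions e (k + N) t c (t + d)).card := by
      refine Finset.card_le_card_of_injOn (fun τ => c + (τ - t)) ?_ ?_
      · intro τ hτ
        simp only [Finset.coe_filter, Finset.mem_Icc, Set.mem_ofPred_eq] at hτ
        simp only [seenPositions, Finset.coe_filter, Finset.mem_Ico, Set.mem_ofPred_eq]
        have h3 : t + (c + (τ - t) - c) = τ := by omega
        rw [h3]
        refine ⟨by omega, by omega, by simpa using hτ.2⟩
      · intro τ hτ τ' hτ' h
        simp only [Finset.coe_filter, Finset.mem_Icc, Set.mem_ofPred_eq] at hτ hτ'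
        dsimp only at h
        omega
    have h3 := Finset.card_filter_add_card_filter_not (s := Finset.Icc t (t + w))
      (fun τ => e τ = true)
    rw [Nat.card_Icc] at h3
    unfold erasureCount
    omega
  refine le_trans ?_ h1
  rcases le_total d (k + N - 1 - c) with h | h
  · rw [min_eq_left h] at hw
    rw [hw]
    exact min_le_left _ _
  · rw [min_eq_right h] at hw
    have := he (t + w)
    omega

/-- The number of symbols that the relay spends in slot `s` on the message of slot `t`, which
consists of `n` symbols. If the source packet of slot `t` is lost, each further erasure up to slot
`s` removes one of the `D` slots over which the message can be spread. -/
def relayShare (n D : ℕ) (e : ℕ → Bool) (t s : ℕ) : ℕ :=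
  if e t = true then n / (D - erasureCount e t s) else n / D

/-- The coordinates of the message of slot `t` that the relay can estimate in slot `s`. Coordinate
`j` is copy `j % L` of symbol `j / L`. -/
def availableCoords (k L D : ℕ) (e : ℕ → Bool) (t s : ℕ) : Finset (Fin (k * L)) :=
  Finset.univ.filter fun j =>
    e t = false ∨ k - (j : ℕ) / L ≤ (seenPositions e D t ((j : ℕ) / L) s).card

/-- The relay packets of any `k + N` of the slots `t, …, t + T` determine the message of
slot `t`. -/
theorem eq_zero_of_relay_combinations {K : Type*} [Field K] {k N L T t : ℕ} (hk : 0 < k)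
    (hL : 0 < L) (hdvd : ∀ j ≤ N, k + N - j ∣ L) {G : ℕ → Fin (k * L) → K}
    (hG : IsGenericMatrix ((T + 1) * (k * L)) G) {e : ℕ → Bool}
    (he : ∀ s, erasureCount e t s ≤ N) {S : Finset ℕ} (hS : ∀ d ∈ S, d ≤ T)
    (hcard : k + N ≤ S.card) {v : Fin (k * L) → K}
    (hv : ∀ d ∈ S, ∀ l < relayShare (k * L) (k + N) e t (t + d),
      ∑ j ∈ availableCoords k L (k + N) e t (t + d),
        G ((T - d) * (k * L) + l) j * v j = 0) : v = 0 := by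
  have hlater : ∀ d, k + N - 1 - d ≤ (S.filter (d < ·)).card := by
    intro d
    have h1 := Finset.card_filter_add_card_filter_not (s := S) (d < ·)
    have h2 : (S.filter fun x => ¬ d < x).card ≤ d + 1 := by
      rw [← Finset.card_range (d + 1)]
      refine Finset.card_le_card fun x hx => ?_
      have := (Finset.mem_filter.1 hx).2
      exact Finset.mem_range.2 (by omega)
    omega
  have hsum : e t = true → ∀ d, (k - (d + 1 - erasureCount e t (t + d))) * L ≤
      ∑ d' ∈ S.filter (d < ·), relayShare (k * L) (k + N) e t (t + d') := by
    intro het d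
    set j := erasureCount e t (t + d) with hj
    have hjN : j ≤ N := he _
    by_cases hA : k ≤ d + 1 - j
    · simp [Nat.sub_eq_zero_of_le hA]
    have hjd : j ≤ d + 1 := by
      have := Finset.card_filter_le (Finset.Icc t (t + d)) fun τ => e τ = true
      rw [Nat.card_Icc] at this
      have h2 : j = ((Finset.Icc t (t + d)).filter fun τ => e τ = true).card := hj
      omega
    set q := k * L / (k + N - j) with hq
    have hqmul : (k + N - j) * q = k * L :=
      Nat.mul_div_cancel' ((hdvd j hjN).mul_left k)
    have hqL : q ≤ L := by
      refine Nat.le_of_mul_le_mul_left ?_ hk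
      rw [← hqmul]
      exact Nat.mul_le_mul_right q (by omega)
    have h1 : (k + N - 1 - d) * q ≤
        ∑ d' ∈ S.filter (d < ·), relayShare (k * L) (k + N) e t (t + d') := by
      refine (Nat.mul_le_mul_right q (hlater d)).trans ?_
      rw [← smul_eq_mul]
      refine Finset.card_nsmul_le_sum _ _ _ fun d' hd' => ?_
      have hdd' := (Finset.mem_filter.1 hd').2
      rw [relayShare, if_pos het]
      have h3 := erasureCount_mono e t (show t + d ≤ t + d' by omega)
      have h4 := he (t + d')
      exact Nat.div_le_div_left (by omega) (by omega)
    refine le_trans ?_ h1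
    obtain ⟨A, hAdef⟩ : ∃ A, A = d + 1 - j := ⟨_, rfl⟩
    rw [← hAdef] at hA ⊢
    have h5 : k + N - 1 - d = k + N - j - A := by omega
    rw [h5, Nat.sub_mul, Nat.sub_mul, hqmul]
    exact Nat.sub_le_sub_left (Nat.mul_le_mul_left A hqL) _
  refine eq_zero_of_generic_combinations hG hS
    (a := fun d => relayShare (k * L) (k + N) e t (t + d))
    (b := fun d => if e t = true then (k - (d + 1 - erasureCount e t (t + d))) * L else 0)
    (Z := fun d => availableCoords k L (k + N) e t (t + d)) ?_ ?_ ?_ ?_ hv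
  · intro d
    dsimp only [relayShare]
    split_ifs <;> exact Nat.div_le_self _ _
  · intro d _ j hj
    refine Finset.mem_filter.2 ⟨Finset.mem_univ _, ?_⟩
    by_cases het : e t = true
    · right
      rw [if_pos het, ← Nat.le_div_iff_mul_le hL] at hj
      have hc : (j : ℕ) / L < k := (Nat.div_lt_iff_lt_mul hL).2 j.2
      refine le_trans ?_ (card_seenPositions he hc)
      omega
    · left
      simpa using het
  · by_cases het : e t = true
    · refine le_trans ?_ ((hsum het 0).trans (Finset.sum_le_sum_of_subset
        (Finset.filter_subset _ _)))
      have h1 : 0 < erasureCount e t (t + 0) :=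
        Finset.card_pos.2 ⟨t, by simp [het]⟩
      rw [show k - (0 + 1 - erasureCount e t (t + 0)) = k by omega]
    · have h1 : ∀ d ∈ S, relayShare (k * L) (k + N) e t (t + d) = k * L / (k + N) :=
        fun d _ => if_neg het
      rw [Finset.sum_congr rfl h1, Finset.sum_const, smul_eq_mul]
      have h2 : (k + N) * (k * L / (k + N)) = k * L :=
        Nat.mul_div_cancel' ((hdvd 0 (Nat.zero_le _)).mul_left k)
      calc k * L = (k + N) * (k * L / (k + N)) := h2.symm
        _ ≤ _ := Nat.mul_le_mul_right _ hcard
  · intro d _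
    split_ifs with het
    · exact hsum het d
    · exact Nat.zero_le _

/-! ### The packets -/

theorem seenPositions_congr {e e' : ℕ → Bool} {t s : ℕ}
    (h : ∀ τ, t ≤ τ → τ ≤ s → e τ = e' τ) (D c : ℕ) :
    seenPositions e D t c s = seenPositions e' D t c s := by
  refine Finset.filter_congr fun p _ => and_congr_right fun hp => ?_
  rw [h _ (Nat.le_add_right _ _) hp]

theorem availableCoords_congr {e e' : ℕ → Bool} {t s : ℕ} (hts : t ≤ s)
    (h : ∀ τ, t ≤ τ → τ ≤ s → e τ = e' τ) (k L D : ℕ) :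
    availableCoords k L D e t s = availableCoords k L D e' t s := by
  unfold availableCoords
  simp only [h t le_rfl hts, seenPositions_congr h]

/-- The erasure pattern of the last `T + 1` slots, most recent slot first. Slots before `0` count as
not erased. -/
def recentErasures (T : ℕ) (e : ℕ → Bool) (s : ℕ) : Fin (T + 1) → Bool :=
  fun i => decide ((i : ℕ) ≤ s) && e (s - i)

/-- The share of the message of age `i` in a relay packet, as a function of the recent erasures `h`.
It is `relayShare`, except that patterns with more than `N` erasures get an empty packet; this
keeps the number of possible packets small. -/
def shareOfRecent (n D N : ℕ) {T : ℕ} (h : Fin (T + 1) → Bool) (i : Fin (T + 1)) : ℕ :=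
  if (Finset.univ.filter fun i => h i = true).card ≤ N then
    if h i = true then n / (D - (Finset.univ.filter fun i' => i' ≤ i ∧ h i' = true).card)
    else n / D
  else 0

theorem shareOfRecent_recentErasures (n D : ℕ) {N T : ℕ} {e : ℕ → Bool}
    (he : IsErasureSequence N e) {s : ℕ} {i : Fin (T + 1)} (hi : (i : ℕ) ≤ s) :
    shareOfRecent n D N (recentErasures T e s) i = relayShare n D e (s - i) s := by
  have h1 : (Finset.univ.filter fun i => recentErasures T e s i = true).card ≤ N := by
    refine le_trans (Finset.card_le_card_of_injOn (fun i => s - (i : ℕ)) ?_ ?_)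
      (he.card_filter_le (Finset.range (s + 1)))
    · intro i' hi'
      simp only [recentErasures, Finset.coe_filter, Finset.mem_univ, true_and, Bool.and_eq_true,
        decide_eq_true_eq, Set.mem_ofPred_eq] at hi'
      simp only [Finset.coe_filter, Finset.mem_range, Set.mem_ofPred_eq]
      exact ⟨by omega, hi'.2⟩
    · intro i₁ h₁ i₂ h₂ h
      simp only [recentErasures, Finset.coe_filter, Finset.mem_univ, true_and, Bool.and_eq_true,
        decide_eq_true_eq, Set.mem_ofPred_eq] at h₁ h₂
      dsimp only at h
      ext
      omega
  have h2 : (Finset.univ.filter fun i' => i' ≤ i ∧ recentErasures T e s i' = true).card =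
      erasureCount e (s - i) s := by
    refine Finset.card_bij (fun i' _ => s - (i' : ℕ)) ?_ ?_ ?_
    · intro i' hi'
      simp only [recentErasures, Finset.mem_filter, Finset.mem_univ, true_and, Bool.and_eq_true,
        decide_eq_true_eq, Fin.le_def] at hi'
      simp only [Finset.mem_filter, Finset.mem_Icc]
      exact ⟨by omega, hi'.2.2⟩
    · intro i₁ h₁ i₂ h₂ h
      simp only [recentErasures, Finset.mem_filter, Finset.mem_univ, true_and, Bool.and_eq_true,
        decide_eq_true_eq] at h₁ h₂
      ext
      omega
    · intro τ hτ
      simp only [Finset.mem_filter, Finset.mem_Icc] at hτ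
      have hi2 := i.2
      refine ⟨⟨s - τ, by omega⟩, ?_, ?_⟩
      · have h3 : s - (s - τ) = τ := by omega
        simp only [recentErasures, Finset.mem_filter, Finset.mem_univ, true_and, Bool.and_eq_true,
          decide_eq_true_eq, Fin.le_def, h3]
        exact ⟨by omega, by omega, hτ.2⟩
      · dsimp only
        omega
  have h3 : recentErasures T e s i = e (s - i) := by simp [recentErasures, hi]
  rw [shareOfRecent, if_pos h1, h2, h3, relayShare]

/-- The packets of the relay: a header with the recent erasures, which tells how the remaining
symbols are divided among the messages of ages `0, …, T`. -/
abbrev RelayAlphabet (K : Type*) (n D N T : ℕ) : Type _ :=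
  Σ h : Fin (T + 1) → Bool, ((Σ i : Fin (T + 1), Fin (shareOfRecent n D N h i)) → K)

theorem relayAlphabet_mk_inj {K : Type*} {n D N T : ℕ} {h h' : Fin (T + 1) → Bool} {g g' : ℕ → ℕ → K}
    (H : (⟨h, fun q => g q.1 q.2⟩ : RelayAlphabet K n D N T) = ⟨h', fun q => g' q.1 q.2⟩) :
    h = h' ∧ ∀ i : Fin (T + 1), ∀ l < shareOfRecent n D N h i, g i l = g' i l := by
  obtain rfl : h = h' := congrArg Sigma.fst H
  have H2 := eq_of_heq (Sigma.mk.inj H).2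
  exact ⟨rfl, fun i l hl => congrFun H2 ⟨i, ⟨l, hl⟩⟩⟩

section Packets

variable {K : Type*} [Field K]

/-- Symbol `c` of copy `l` of the message of slot `τ`. -/
def copySymbol {k L : ℕ} (m : ℕ → Fin (k * L) → K) (l τ c : ℕ) : K :=
  if h : l + L * c < k * L then m τ ⟨l + L * c, h⟩ else 0

theorem copySymbol_mod_div {k L : ℕ} (m : ℕ → Fin (k * L) → K) (τ : ℕ) (j : Fin (k * L)) :
    copySymbol m ((j : ℕ) % L) τ ((j : ℕ) / L) = m τ j := by
  have h : (j : ℕ) % L + L * ((j : ℕ) / L) = j := Nat.mod_add_div _ _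
  simp [copySymbol, h]

/-- The source packet of slot `τ`: `L` independent copies of the source code. -/
noncomputable def sourceEncoder (α : ℕ → K) (k L D : ℕ) (τ : ℕ) (m : ℕ → Fin (k * L) → K) :
    Fin L × Fin D → K :=
  fun q => sourceSymbol α k (copySymbol m q.1) τ q.2

theorem sourceEncoder_congr {α : ℕ → K} {k L D : ℕ} {τ : ℕ} {m m' : ℕ → Fin (k * L) → K}
    (h : ∀ s ≤ τ, m s = m' s) : sourceEncoder α k L D τ m = sourceEncoder α k L D τ m' := by
  funext q
  refine sourceSymbol_congr (fun s hs => ?_) _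
  funext c
  simp only [copySymbol, h s hs]

/-- The symbol of copy `l` and position `p` that the relay received in slot `τ`, or `0` if there is
none. -/
def receivedSymbol {L D : ℕ} (z : ℕ → Option (Fin L × Fin D → K)) (l τ p : ℕ) : K :=
  (z τ).elim 0 fun x => if h : l < L ∧ p < D then x (⟨l, h.1⟩, ⟨p, h.2⟩) else 0

/-- The erasure pattern that the relay observes. -/
def observedErasures {X : Type*} (z : ℕ → Option X) (τ : ℕ) : Bool := (z τ).isNone

/-- The relay's estimate in slot `s` of coordinate `j` of the message of slot `t`. -/
noncomputable def relayEstimate (α : ℕ → K) {L D : ℕ} (z : ℕ → Option (Fin L × Fin D → K))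
    (t s j : ℕ) : K :=
  if observedErasures z t = false then receivedSymbol z (j % L) t (j / L)
  else estimate α D (observedErasures z) (receivedSymbol z (j % L)) t (j / L) s

/-- The combination with index `l` of available estimates that the relay forms in slot `s` for the
message of slot `t`. -/
noncomputable def relayCombination (α : ℕ → K) {k L D : ℕ} (T : ℕ) (G : ℕ → Fin (k * L) → K)
    (z : ℕ → Option (Fin L × Fin D → K)) (t s l : ℕ) : K :=
  ∑ j ∈ availableCoords k L D (observedErasures z) t s,
    G ((T - (s - t)) * (k * L) + l) j * relayEstimate α z t s j

/-- The relay packet of slot `s`, computed from what the relay has received. -/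
noncomputable def relayEncoder (α : ℕ → K) {k L D : ℕ} (N T : ℕ) (G : ℕ → Fin (k * L) → K)
    (s : ℕ) (z : ℕ → Option (Fin L × Fin D → K)) : RelayAlphabet K (k * L) D N T :=
  ⟨recentErasures T (observedErasures z) s,
    fun q => relayCombination α T G z (s - q.1) s q.2⟩

variable {α : ℕ → K} {k L D : ℕ}

theorem receivedSymbol_eq {z : ℕ → Option (Fin L × Fin D → K)} {e : ℕ → Bool}
    {m : ℕ → Fin (k * L) → K} {τ : ℕ} (hz : z τ = erase (e τ) (sourceEncoder α k L D τ m))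
    (he : e τ = false) {l p : ℕ} (hl : l < L) (hp : p < D) :
    receivedSymbol z l τ p = sourceSymbol α k (copySymbol m l) τ p := by
  simp [receivedSymbol, hz, he, erase, hl, hp, sourceEncoder]

theorem observedErasures_eq {X : Type*} {z : ℕ → Option X} {e : ℕ → Bool} {x : X} {τ : ℕ}
    (hz : z τ = erase (e τ) x) : observedErasures z τ = e τ := by
  cases h : e τ <;> simp [observedErasures, hz, h, erase]

theorem relayEstimate_sub_relayEstimate (hα : Set.InjOn α (Set.Iio D)) (hk : k ≤ D) (hL : 0 < L)
    {z z' : ℕ → Option (Fin L × Fin D → K)} {e : ℕ → Bool} {m m' : ℕ → Fin (k * L) → K} {t s : ℕ}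
    (hts : t ≤ s) (hz : ∀ τ ≤ s, z τ = erase (observedErasures z τ) (sourceEncoder α k L D τ m))
    (hz' : ∀ τ ≤ s, z' τ = erase (observedErasures z' τ) (sourceEncoder α k L D τ m'))
    (he : ∀ τ, t ≤ τ → τ ≤ s → observedErasures z τ = e τ)
    (he' : ∀ τ, t ≤ τ → τ ≤ s → observedErasures z' τ = e τ)
    (hm : ∀ τ < t, m τ = m' τ) {j : Fin (k * L)} (hj : j ∈ availableCoords k L D e t s) :
    relayEstimate α z t s j - relayEstimate α z' t s j = m t j - m' t j := by
  have hc : (j : ℕ) / L < k := (Nat.div_lt_iff_lt_mul hL).2 j.2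
  have hl : (j : ℕ) % L < L := Nat.mod_lt _ hL
  rw [← copySymbol_mod_div m, ← copySymbol_mod_div m']
  unfold relayEstimate
  rw [he t le_rfl hts, he' t le_rfl hts]
  split_ifs with het
  · rw [receivedSymbol_eq (hz t hts) ((he t le_rfl hts).trans het) hl (hc.trans_le hk),
      receivedSymbol_eq (hz' t hts) ((he' t le_rfl hts).trans het) hl (hc.trans_le hk)]
    simp [sourceSymbol, hc]
  · have hcard := (Finset.mem_filter.1 hj).2.resolve_left het
    have hu : ∀ τ < t, copySymbol m ((j : ℕ) % L) τ = copySymbol m' ((j : ℕ) % L) τ := by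
      intro τ hτ
      funext c
      simp only [copySymbol, hm τ hτ]
    have e1 : estimate α D (observedErasures z') (receivedSymbol z' ((j : ℕ) % L)) t (j / L) s =
        estimate α D (observedErasures z) (receivedSymbol z' ((j : ℕ) % L)) t (j / L) s := by
      unfold estimate
      rw [seenPositions_congr (fun τ h1 h2 => (he' τ h1 h2).trans (he τ h1 h2).symm)]
    have e2 : seenPositions e D t ((j : ℕ) / L) s =
        seenPositions (observedErasures z) D t ((j : ℕ) / L) s :=
      seenPositions_congr (fun τ h1 h2 => (he τ h1 h2).symm) _ _
    rw [e2] at hcard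
    rw [e1]
    refine estimate_sub_estimate hα hk hc hcard hu ?_ ?_
    · intro τ _ h2 h3 p hp
      exact receivedSymbol_eq (hz τ h2) h3 hl hp
    · intro τ h1 h2 h3 p hp
      exact receivedSymbol_eq (hz' τ h2) (((he' τ h1 h2).trans (he τ h1 h2).symm).trans h3) hl hp

/-- What one relay packet tells about the message of slot `t` once all older messages are known. The
header makes the two erasure patterns agree, so the two packets are the same linear function of
their messages, up to terms that cancel. -/
theorem relay_combinations_eq_zero (hα : Set.InjOn α (Set.Iio D)) (hk : k ≤ D) (hL : 0 < L)
    {N T : ℕ} {G : ℕ → Fin (k * L) → K} {z z' : ℕ → Option (Fin L × Fin D → K)}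
    {e e' : ℕ → Bool} (heN : IsErasureSequence N e) {m m' : ℕ → Fin (k * L) → K} {t d : ℕ}
    (hd : d ≤ T) (hz : ∀ τ ≤ t + d, z τ = erase (e τ) (sourceEncoder α k L D τ m))
    (hz' : ∀ τ ≤ t + d, z' τ = erase (e' τ) (sourceEncoder α k L D τ m'))
    (hm : ∀ τ < t, m τ = m' τ)
    (H : relayEncoder α N T G (t + d) z = relayEncoder α N T G (t + d) z') {l : ℕ}
    (hl : l < relayShare (k * L) D e t (t + d)) :
    ∑ j ∈ availableCoords k L D e t (t + d),
      G ((T - d) * (k * L) + l) j * (m t - m' t) j = 0 := by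
  obtain ⟨hhead, hval⟩ := relayAlphabet_mk_inj
    (g := fun i l => relayCombination α T G z (t + d - i) (t + d) l)
    (g' := fun i l => relayCombination α T G z' (t + d - i) (t + d) l) H
  have hobs : ∀ τ ≤ t + d, observedErasures z τ = e τ := fun τ hτ => observedErasures_eq (hz τ hτ)
  have hobs' : ∀ τ ≤ t + d, observedErasures z' τ = e' τ :=
    fun τ hτ => observedErasures_eq (hz' τ hτ)
  have hrec : recentErasures T (observedErasures z) (t + d) = recentErasures T e (t + d) := by
    funext i
    simp only [recentErasures]
    rw [hobs _ (Nat.sub_le _ _)]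
  have hee' : ∀ τ, t ≤ τ → τ ≤ t + d → observedErasures z' τ = e τ := by
    intro τ h1 h2
    have h3 := congrFun hhead ⟨t + d - τ, by omega⟩
    have h4 : t + d - (t + d - τ) = τ := by omega
    simp only [recentErasures, h4] at h3
    rw [← hobs τ h2]
    simpa using h3.symm
  have hi : d ≤ t + d := Nat.le_add_left _ _
  have hsub : t + d - d = t := Nat.add_sub_cancel _ _
  have hsub' : t + d - t = d := Nat.add_sub_cancel_left _ _
  have hshare : shareOfRecent (k * L) D N (recentErasures T (observedErasures z) (t + d))
      ⟨d, Nat.lt_succ_of_le hd⟩ = relayShare (k * L) D e t (t + d) := by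
    rw [hrec, shareOfRecent_recentErasures _ _ heN (by exact hi)]
    simp only [hsub]
  have h1 := hval ⟨d, Nat.lt_succ_of_le hd⟩ l (by rw [hshare]; exact hl)
  simp only [hsub, relayCombination, hsub'] at h1
  have h0 : t ≤ t + d := Nat.le_add_right _ _
  rw [availableCoords_congr h0 (fun τ _ h => hobs τ h), availableCoords_congr h0 hee',
    ← sub_eq_zero, ← Finset.sum_sub_distrib] at h1
  rw [← h1]
  refine Finset.sum_congr rfl fun j hj => ?_
  rw [← mul_sub, relayEstimate_sub_relayEstimate hα hk hL h0
    (fun τ hτ => by rw [hobs τ hτ]; exact hz τ hτ) (fun τ hτ => by rw [hobs' τ hτ]; exact hz' τ hτ)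
    (fun τ _ h => hobs τ h) hee' hm hj, Pi.sub_apply]

/-- The destination can tell different messages apart within the delay `T`. -/
theorem message_eq_of_received_eq {N N₂ T : ℕ} (hk : 0 < k) (hL : 0 < L)
    (hT : T + 1 = k + N + N₂) (hdvd : ∀ j ≤ N, k + N - j ∣ L)
    (hα : Set.InjOn α (Set.Iio (k + N))) {G : ℕ → Fin (k * L) → K}
    (hG : IsGenericMatrix ((T + 1) * (k * L)) G) {e e' eR eR' : ℕ → Bool}
    (he : IsErasureSequence N e) (heR : IsErasureSequence N₂ eR) {m m' : ℕ → Fin (k * L) → K}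
    {z z' : ℕ → ℕ → Option (Fin L × Fin (k + N) → K)}
    (hz : ∀ s, ∀ τ ≤ s, z s τ = erase (e τ) (sourceEncoder α k L (k + N) τ m))
    (hz' : ∀ s, ∀ τ ≤ s, z' s τ = erase (e' τ) (sourceEncoder α k L (k + N) τ m')) (t : ℕ)
    (H : ∀ s ≤ t + T, erase (eR s) (relayEncoder α N T G s (z s)) =
      erase (eR' s) (relayEncoder α N T G s (z' s))) : m t = m' t := by
  induction t using Nat.strong_induction_on with
  | _ t ih =>
    have hm : ∀ τ < t, m τ = m' τ := fun τ hτ => ih τ hτ fun s hs => H s (by omega)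
    rw [← sub_eq_zero]
    refine eq_zero_of_relay_combinations hk hL hdvd hG (e := e) (t := t)
      (S := (Finset.range (T + 1)).filter fun d => eR (t + d) = false)
      (fun s => he.card_filter_le _) ?_ ?_ ?_
    · intro d hd
      have := Finset.mem_range.1 (Finset.mem_filter.1 hd).1
      omega
    · have h1 := Finset.card_filter_add_card_filter_not (s := Finset.range (T + 1))
        (fun d => eR (t + d) = true)
      have h2 : ((Finset.range (T + 1)).filter fun d => eR (t + d) = true).card ≤ N₂ := by
        refine le_trans (Finset.card_le_card_of_injOn (t + ·) ?_ (add_right_injective t).injOn)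
          (heR.card_filter_le (Finset.range (t + T + 1)))
        intro d hd
        simp only [Finset.coe_filter, Finset.mem_range, Set.mem_ofPred_eq] at hd ⊢
        exact ⟨by omega, hd.2⟩
      rw [Finset.card_range] at h1
      simp only [Bool.not_eq_true] at h1
      omega
    · intro d hd l hl
      obtain ⟨hdT, hdR⟩ := Finset.mem_filter.1 hd
      rw [Finset.mem_range] at hdT
      have h1 := H (t + d) (by omega)
      have h2 : relayEncoder α N T G (t + d) (z (t + d)) =
          relayEncoder α N T G (t + d) (z' (t + d)) := by
        cases h : eR' (t + d)
        · simpa [erase, hdR, h] using h1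
        · simp [erase, hdR, h] at h1
      exact relay_combinations_eq_zero hα (Nat.le_add_right _ _) hL he (by omega)
        (hz _) (hz' _) hm h2 hl

end Packets

/-! ### The size of the relay packets -/

/-- A sum over a finite set of a function of the rank of the element. -/
theorem sum_apply_card_filter {ι : Type*} [LinearOrder ι] (f : ℕ → ℕ) (H : Finset ι) :
    ∑ i ∈ H, f (H.filter (· ≤ i)).card = ∑ j ∈ Finset.range H.card, f (j + 1) := by
  induction H using Finset.induction_on_max with
  | empty => simp
  | insert a s hs ih =>
    have ha : a ∉ s := fun h => lt_irrefl a (hs a h)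
    rw [Finset.sum_insert ha, Finset.card_insert_of_notMem ha, Finset.sum_range_succ, add_comm]
    congr 1
    · rw [← ih]
      refine Finset.sum_congr rfl fun i hi => ?_
      rw [Finset.filter_insert, if_neg (not_le.2 (hs i hi))]
    · have h1 : (insert a s).filter (· ≤ a) = insert a s :=
        Finset.filter_true_of_mem fun x hx => by
          rcases Finset.mem_insert.1 hx with rfl | hx
          · exact le_rfl
          · exact (hs x hx).le
      rw [h1, Finset.card_insert_of_notMem ha]

/-- The worst case is a pattern with `N` erasures, whose messages have the shares
`n / (D - 1), …, n / (D - N)`. -/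
theorem sum_shareOfRecent_le (n D : ℕ) {N T : ℕ} (hND : N < D) (hNT : N ≤ T + 1)
    (h : Fin (T + 1) → Bool) :
    ∑ i, shareOfRecent n D N h i ≤
      ∑ j ∈ Finset.range N, n / (D - (j + 1)) + (T + 1 - N) * (n / D) := by
  set H := Finset.univ.filter fun i => h i = true with hH
  by_cases hN : H.card ≤ N
  · have h1 : ∀ i, shareOfRecent n D N h i =
        if h i = true then n / (D - (H.filter (· ≤ i)).card) else n / D := by
      intro i
      rw [shareOfRecent, if_pos hN, hH, Finset.filter_filter]
      simp only [and_comm]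
    have h2 : (Finset.univ.filter fun i => ¬ h i = true).card = T + 1 - H.card := by
      have := Finset.card_filter_add_card_filter_not (s := (Finset.univ : Finset (Fin (T + 1))))
        (fun i => h i = true)
      rw [← hH, Finset.card_univ, Fintype.card_fin] at this
      omega
    rw [Finset.sum_congr rfl fun i _ => h1 i, Finset.sum_ite, ← hH,
      sum_apply_card_filter (fun j => n / (D - j)), Finset.sum_const, h2, smul_eq_mul]
    obtain ⟨r, hr⟩ := Nat.exists_eq_add_of_le hN
    have h3 : r * (n / D) ≤ ∑ x ∈ Finset.range r, n / (D - (H.card + x + 1)) := by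
      have := Finset.card_nsmul_le_sum (Finset.range r)
        (fun x => n / (D - (H.card + x + 1))) (n / D) fun x hx => by
          have := Finset.mem_range.1 hx
          exact Nat.div_le_div_left (Nat.sub_le _ _) (by omega)
      simpa using this
    have h4 : T + 1 - H.card = r + (T + 1 - N) := by omega
    rw [h4, add_mul, hr, Finset.sum_range_add, ← hr]
    omega
  · have h1 : ∀ i, shareOfRecent n D N h i = 0 := fun i => if_neg hN
    simp [h1]

theorem card_relayAlphabet_le (K : Type*) [Fintype K] [Nonempty K] (n D : ℕ) {N T : ℕ}
    (hND : N < D) (hNT : N ≤ T + 1) :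
    Nat.card (RelayAlphabet K n D N T) ≤ 2 ^ (T + 1) * Fintype.card K ^
      (∑ j ∈ Finset.range N, n / (D - (j + 1)) + (T + 1 - N) * (n / D)) := by
  classical
  rw [Nat.card_eq_fintype_card, Fintype.card_sigma]
  have h1 : ∀ h : Fin (T + 1) → Bool,
      Fintype.card ((Σ i : Fin (T + 1), Fin (shareOfRecent n D N h i)) → K) ≤
        Fintype.card K ^ (∑ j ∈ Finset.range N, n / (D - (j + 1)) + (T + 1 - N) * (n / D)) := by
    intro h
    rw [Fintype.card_fun, Fintype.card_sigma]
    refine Nat.pow_le_pow_right Fintype.card_pos ?_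
    simpa using sum_shareOfRecent_le n D hND hNT h
  refine (Finset.sum_le_card_nsmul _ _ _ fun h _ => h1 h).trans_eq ?_
  simp

/-! ### From arbitrary packet alphabets to a streaming code -/

/-- Packets from arbitrary finite sets `M`, `X`, `Y` can be embedded into vectors over `F`, and the
decoder exists as soon as the destination can tell different messages apart. -/
theorem exists_isAchievable {F M X Y : Type*} [Field F] [Fintype F] [Finite M] [Finite X]
    [Finite Y] [Nonempty M] [Nonempty X] {n₁ n₂ k T N₁ N₂ : ℕ}
    (enc : ℕ → (ℕ → M) → X) (rel : ℕ → (ℕ → Option X) → Y)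
    (henc : ∀ t m m', (∀ s ≤ t, m s = m' s) → enc t m = enc t m')
    (hM : Fintype.card F ^ k ≤ Nat.card M) (hX : Nat.card X ≤ Fintype.card F ^ n₁)
    (hY : Nat.card Y ≤ Fintype.card F ^ n₂)
    (hdec : ∀ (m m' : ℕ → M) (e e' eR eR' : ℕ → Bool), IsErasureSequence N₁ e →
      IsErasureSequence N₂ eR → ∀ z z' : ℕ → ℕ → Option X,
      (∀ s, ∀ τ ≤ s, z s τ = erase (e τ) (enc τ m)) →
      (∀ s, ∀ τ ≤ s, z' s τ = erase (e' τ) (enc τ m')) → ∀ t,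
      (∀ s ≤ t + T, erase (eR s) (rel s (z s)) = erase (eR' s) (rel s (z' s))) → m t = m' t) :
    ∃ C : StreamingCode F n₁ n₂ k T, C.IsAchievable N₁ N₂ := by
  classical
  have := Fintype.ofFinite M
  have := Fintype.ofFinite X
  have := Fintype.ofFinite Y
  obtain ⟨ψ⟩ : Nonempty ((Fin k → F) ↪ M) := by
    rw [Function.Embedding.nonempty_iff_card_le, Fintype.card_fun, Fintype.card_fin,
      ← Nat.card_eq_fintype_card (α := M)]
    exact hM
  obtain ⟨φ⟩ : Nonempty (X ↪ (Fin n₁ → F)) := by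
    rw [Function.Embedding.nonempty_iff_card_le, Fintype.card_fun, Fintype.card_fin,
      ← Nat.card_eq_fintype_card (α := X)]
    exact hX
  obtain ⟨χ⟩ : Nonempty (Y ↪ (Fin n₂ → F)) := by
    rw [Function.Embedding.nonempty_iff_card_le, Fintype.card_fun, Fintype.card_fin,
      ← Nat.card_eq_fintype_card (α := Y)]
    exact hY
  -- What the relay knows in slot `s`, as a sequence of packets over the alphabet `X`.
  let known : (m : ℕ → Fin k → F) → (ℕ → Bool) → ℕ → ℕ → Option X := fun m e s τ =>
    if τ < s + 1 then erase (e τ) (enc τ fun i => ψ (m i)) else none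
  -- What the destination receives.
  let received : (m : ℕ → Fin k → F) → (e eR : ℕ → Bool) → ℕ → Option (Fin n₂ → F) :=
    fun m e eR s => erase (eR s) (χ (rel s (known m e s)))
  let C : StreamingCode F n₁ n₂ k T :=
    { encS := fun t a => φ (enc t fun s => if h : s < t + 1 then ψ (a ⟨s, h⟩) else Classical.arbitrary M)
      encR := fun t a => χ (rel t fun s =>
        if h : s < t + 1 then (a ⟨s, h⟩).map (Function.invFun φ) else none)
      dec := fun t a =>
        if h : ∃ (m : ℕ → Fin k → F) (e eR : ℕ → Bool), IsErasureSequence N₁ e ∧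
            IsErasureSequence N₂ eR ∧ (fun s : Fin (t + T + 1) => received m e eR s) = a
        then h.choose t else 0 }
  have hsource : ∀ m t, C.sourcePacket m t = φ (enc t fun i => ψ (m i)) := by
    intro m t
    refine congrArg φ (henc _ _ _ fun s hs => ?_)
    simp [Nat.lt_succ_of_le hs]
  have hrelay : ∀ m e t, C.relayPacket m e t = χ (rel t (known m e t)) := by
    intro m e t
    refine congrArg χ (congrArg (rel t) (funext fun s => ?_))
    by_cases hs : s < t + 1
    · simp only [hs, dif_pos, known, StreamingCode.relayReceived, hsource, erase, if_true]
      split_ifs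
      · rfl
      · simp [Function.leftInverse_invFun φ.injective _]
    · simp only [hs, dif_neg, not_false_eq_true, if_false, known]
  have hdest : ∀ m e eR s, C.destReceived m e eR s = received m e eR s := by
    intro m e eR s
    rw [StreamingCode.destReceived, hrelay]
  refine ⟨C, fun m e eR he heR t => ?_⟩
  have hex : ∃ (m' : ℕ → Fin k → F) (e' eR' : ℕ → Bool), IsErasureSequence N₁ e' ∧
      IsErasureSequence N₂ eR' ∧ (fun s : Fin (t + T + 1) => received m' e' eR' s) =
        fun s : Fin (t + T + 1) => C.destReceived m e eR s :=
    ⟨m, e, eR, he, heR, funext fun s => (hdest m e eR s).symm⟩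
  have hdecoded : C.decoded m e eR t = hex.choose t := dif_pos hex
  rw [hdecoded]
  obtain ⟨e', eR', he', heR', heq⟩ := hex.choose_spec
  refine ψ.injective (hdec (fun i => ψ (hex.choose i)) (fun i => ψ (m i)) e' e eR' eR he' heR'
    (known hex.choose e') (known m e) ?_ ?_ t ?_)
  · intro s τ hτ
    exact if_pos (Nat.lt_succ_of_le hτ)
  · intro s τ hτ
    exact if_pos (Nat.lt_succ_of_le hτ)
  · intro s hs
    have h1 := congrFun heq ⟨s, Nat.lt_succ_of_le hs⟩
    dsimp only at h1
    rw [hdest] at h1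
    simp only [received, erase] at h1 ⊢
    split_ifs at h1 ⊢ <;> simp_all

/-- The adaptive relaying code exists for every packet size `n₂` of the relay that holds the header
and the relay symbols. -/
theorem exists_isAchievable_of_le (F : Type*) [Field F] [Fintype F] {k L N₁ N₂ T : ℕ} (hk : 0 < k)
    (hL : 0 < L) (hT : T + 1 = k + N₁ + N₂) (hdvd : ∀ j ≤ N₁, k + N₁ - j ∣ L) :
    ∃ d, 0 < d ∧ ∀ n₂,
      T + 1 + d * (∑ j ∈ Finset.range N₁, k * L / (k + N₁ - (j + 1)) +
        (T + 1 - N₁) * (k * L / (k + N₁))) ≤ n₂ →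
      ∃ C : StreamingCode F (d * (L * (k + N₁))) n₂ (d * (k * L)) T, C.IsAchievable N₁ N₂ := by
  obtain ⟨K, _, _, d, hd, hK, ⟨α, hα⟩, G, hG⟩ :=
    exists_extension_isGenericMatrix F (k * L) ((T + 1) * (k * L)) (k + N₁)
  refine ⟨d, hd, fun n₂ hn₂ => exists_isAchievable (M := Fin (k * L) → K)
    (X := Fin L × Fin (k + N₁) → K) (Y := RelayAlphabet K (k * L) (k + N₁) N₁ T)
    (sourceEncoder α k L (k + N₁)) (relayEncoder α N₁ T G)
    (fun t m m' h => sourceEncoder_congr h) ?_ ?_ ?_ ?_⟩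
  · simp [hK, pow_mul]
  · simp [hK, pow_mul]
  · refine (card_relayAlphabet_le K (k * L) (k + N₁) (by omega) (by omega)).trans ?_
    rw [hK, ← pow_mul]
    refine le_trans ?_ (Nat.pow_le_pow_right Fintype.card_pos hn₂)
    rw [pow_add (Fintype.card F)]
    exact Nat.mul_le_mul_right _ (Nat.pow_le_pow_left (Fintype.one_lt_card (α := F)) _)
  · intro m m' e e' eR eR' he heR z z' hz hz' t H
    exact message_eq_of_received_eq hk hL hT hdvd hα hG he heR hz hz' t H

/-! ### The rate -/

theorem div_max_eq_min_div {a x y : ℝ} (ha : 0 ≤ a) (hx : 0 < x) (hy : 0 < y) :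
    a / max x y = min (a / x) (a / y) := by
  rcases le_total x y with h | h
  · rw [max_eq_right h, min_eq_right (div_le_div_of_nonneg_left ha hx h)]
  · rw [max_eq_left h, min_eq_left (div_le_div_of_nonneg_left ha hy h)]

/-- The relay symbols fill up `1 / D` times the denominator of the rate bound of the second
link. -/
theorem cast_relay_symbols {n k N T : ℕ} (hk : 0 < k) (hNT : N ≤ T + 1)
    (hdvd : ∀ j ≤ N, k + N - j ∣ n) :
    (((∑ j ∈ Finset.range N, n / (k + N - (j + 1)) + (T + 1 - N) * (n / (k + N)) : ℕ)) : ℝ) *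
        ((k : ℝ) + N) =
      n * ((T : ℝ) + 1 + ∑ i ∈ Finset.range (N + 1),
        ((N : ℝ) - i) / ((k : ℝ) + N - ((N : ℝ) - i))) := by
  have hk' : (0 : ℝ) < k := Nat.cast_pos.2 hk
  have hterm : ∀ j ∈ Finset.range N, ((n / (k + N - (j + 1)) : ℕ) : ℝ) * ((k : ℝ) + N) =
      n * (1 + ((j : ℝ) + 1) / ((k : ℝ) + N - ((j : ℝ) + 1))) := by
    intro j hj
    have hj' := Finset.mem_range.1 hj
    have hjr : (j : ℝ) + 1 ≤ N := by exact_mod_cast hj'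
    have hpos : (0 : ℝ) < (k : ℝ) + N - ((j : ℝ) + 1) := by linarith
    have hcast : ((k + N - (j + 1) : ℕ) : ℝ) = (k : ℝ) + N - ((j : ℝ) + 1) := by
      rw [Nat.cast_sub (by omega)]
      push_cast
      ring
    rw [Nat.cast_div (hdvd _ hj') (by rw [hcast]; exact hpos.ne'), hcast]
    field_simp
    ring
  have hlast : ((n / (k + N) : ℕ) : ℝ) * ((k : ℝ) + N) = n := by
    exact_mod_cast Nat.div_mul_cancel (by simpa using hdvd 0 (Nat.zero_le _))
  have hreflect : ∑ i ∈ Finset.range (N + 1), ((N : ℝ) - i) / ((k : ℝ) + N - ((N : ℝ) - i)) =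
      ∑ j ∈ Finset.range N, ((j : ℝ) + 1) / ((k : ℝ) + N - ((j : ℝ) + 1)) := by
    rw [Finset.sum_range_succ, sub_self, zero_div, add_zero,
      ← Finset.sum_range_reflect (fun j : ℕ => ((j : ℝ) + 1) / ((k : ℝ) + N - ((j : ℝ) + 1)))]
    refine Finset.sum_congr rfl fun i hi => ?_
    have hi' := Finset.mem_range.1 hi
    have h1 : ((N - 1 - i : ℕ) : ℝ) + 1 = (N : ℝ) - i := by
      have h2 : N - 1 - i + 1 + i = N := by omega
      have h3 : ((N - 1 - i : ℕ) : ℝ) + 1 + i = N := by exact_mod_cast h2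
      linarith
    rw [h1]
  rw [hreflect]
  push_cast [Nat.cast_sub hNT]
  rw [add_mul, Finset.sum_mul, Finset.sum_congr rfl hterm, mul_assoc, hlast, ← Finset.mul_sum,
    Finset.sum_add_distrib, Finset.sum_const, Finset.card_range]
  simp only [nsmul_eq_mul, mul_one]
  ring

theorem theorem1 (N₁ N₂ T : ℕ) (hT : N₁ + N₂ ≤ T) (F : Type*) [Field F] [Fintype F] :
    ∃ δ : ℕ → ℝ,
      Tendsto δ atTop (𝓝 0) ∧
      ∀ c : ℕ, 1 ≤ c →
        0 ≤ δ c ∧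
        δ c ≤ (1 / (c : ℝ)) *
          ((⌈((T : ℝ) + 1) * Real.logb (Fintype.card F : ℝ) 2⌉ : ℤ) : ℝ) ∧
        ∃ (n₁ n₂ k : ℕ) (C : StreamingCode F n₁ n₂ k T),
          C.IsAchievable N₁ N₂ ∧
          C.rate =
            min
              (((T : ℝ) + 1 - (N₁ : ℝ) - (N₂ : ℝ)) / ((T : ℝ) + 1 - (N₂ : ℝ)))
              (((T : ℝ) + 1 - (N₂ : ℝ)) /
                ((T : ℝ) + 1 +
                  (∑ i ∈ Finset.range (N₁ + 1),
                    ((N₁ : ℝ) - (i : ℝ)) /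
                      ((T : ℝ) + 1 - (N₂ : ℝ) - ((N₁ : ℝ) - (i : ℝ)))) +
                  δ c)) := by
  refine ⟨fun c => 1 / (c : ℝ), tendsto_one_div_atTop_nhds_zero_nat, fun c hc => ?_⟩
  have hc0 : (0 : ℝ) < c := Nat.cast_pos.2 hc
  refine ⟨by positivity, ?_, ?_⟩
  · have hlog : 0 < Real.logb (Fintype.card F : ℝ) 2 :=
      Real.logb_pos (by exact_mod_cast Fintype.one_lt_card) one_lt_two
    have hceil : 0 < ⌈((T : ℝ) + 1) * Real.logb (Fintype.card F : ℝ) 2⌉ :=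
      Int.ceil_pos.2 (by positivity)
    exact le_mul_of_one_le_right (by positivity) (by exact_mod_cast hceil)
  obtain ⟨k, hkT⟩ : ∃ k, T + 1 = k + N₁ + N₂ := ⟨T + 1 - N₁ - N₂, by omega⟩
  have hk : 0 < k := by omega
  -- The factor `(k + N₁)!` makes all shares integral. The other factors make the slack `δ c = 1 / c`
  -- worth `k * ((T + 1) * (k + N₁)!)` symbols, which is enough room for the header.
  set f := (T + 1) * (k + N₁).factorial with hf
  have hf0 : 0 < f := Nat.mul_pos (Nat.succ_pos T) (Nat.factorial_pos _)
  set L := c * (k + N₁) * f with hLdef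
  have hL : 0 < L := Nat.mul_pos (Nat.mul_pos hc (by omega)) hf0
  have hdvd : ∀ j ≤ N₁, k + N₁ - j ∣ L := fun j hj =>
    ((Nat.dvd_factorial (by omega) (Nat.sub_le _ _)).mul_left (T + 1)).mul_left _
  obtain ⟨d, hd, hcode⟩ := exists_isAchievable_of_le F hk hL hkT hdvd
  have hsum := cast_relay_symbols (n := k * L) (T := T) hk (by omega)
    (fun j hj => (hdvd j hj).mul_left k)
  set B := ∑ j ∈ Finset.range N₁, k * L / (k + N₁ - (j + 1)) + (T + 1 - N₁) * (k * L / (k + N₁))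
    with hB
  obtain ⟨C, hC⟩ := hcode (d * (B + k * f)) (by
    have h1 : T + 1 ≤ f := Nat.le_mul_of_pos_right _ (Nat.factorial_pos _)
    have h2 : f ≤ d * (k * f) := by
      rw [← mul_assoc]
      exact Nat.le_mul_of_pos_left _ (Nat.mul_pos hd hk)
    have h3 : d * (B + k * f) = d * B + d * (k * f) := mul_add _ _ _
    change T + 1 + d * B ≤ d * (B + k * f)
    omega)
  refine ⟨_, _, _, C, hC, ?_⟩
  have hTr : (T : ℝ) + 1 = k + N₁ + N₂ := by exact_mod_cast hkT
  have hD : (T : ℝ) + 1 - N₂ = k + N₁ := by linarith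
  have hkr : (0 : ℝ) < k := Nat.cast_pos.2 hk
  have hfr : (0 : ℝ) < f := Nat.cast_pos.2 hf0
  have hdr : (0 : ℝ) < d := Nat.cast_pos.2 hd
  have hLr : (0 : ℝ) < L := Nat.cast_pos.2 hL
  have hLeq : (L : ℝ) = c * (k + N₁) * f := by rw [hLdef]; push_cast; ring
  rw [hD, show (T : ℝ) + 1 - N₁ - N₂ = k by linarith, StreamingCode.rate]
  push_cast at hsum ⊢
  set W := (T : ℝ) + 1 + ∑ i ∈ Finset.range (N₁ + 1),
        ((N₁ : ℝ) - i) / ((k : ℝ) + N₁ - ((N₁ : ℝ) - i)) with hW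
  have hDpos : (0 : ℝ) < (k : ℝ) + N₁ := by positivity
  have hBr : (0 : ℝ) ≤ B := Nat.cast_nonneg _
  have hWpos : 0 ≤ W := by
    have h1 : 0 ≤ (k * L : ℝ) * W := by rw [← hsum]; positivity
    exact nonneg_of_mul_nonneg_right h1 (by positivity)
  rw [div_max_eq_min_div (by positivity) (by positivity) (by positivity)]
  congr 1
  · field_simp
  · rw [div_eq_div_iff (by positivity) (by positivity)]
    have h1 : (k * L : ℝ) * (1 / c) = (k + N₁) * (k * f) := by
      rw [hLeq]
      field_simp
    linear_combination (-(d : ℝ)) * hsum + (d : ℝ) * h1
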